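/- Let $q\ge 2$ and let $T$ be the $(q+1)$-regular tree, oriented so that every vertex has one predecessor (below it) and $q$ successors (above it), with base vertex $o$. For each vertex, the edges to its $q$ successors are labelled bijectively by $\{0,1,\dots,q-1\}$, and no edge on the downward ray from $o$ (through its iterated predecessors) has label $1$; for instance, all of them have label $0$. For a vertex $v$ let $o\curlywedge v$ be the greatest common ancestor of $o$ and $v$, and put $l(v)=d(v,o\curlywedge v)$, $m(v)=d(o,o\curlywedge v)$, $h(v)=l(v)-m(v)$. Let $T_1,T_2,T_3$ be copies of $T$. The Diestel–Leader graph $DL_3(q)$ has as vertices the triples $v=(v_1,v_2,v_3)$, $v_i\in T_i$, with $h(v_1)+h(v_2)+h(v_3)=0$; two vertices $v,w$ are adjacent if there are $i\ne j$ such that $v_i,w_i$ are adjacent in $T_i$, $v_j,w_j$ are adjacent in $T_j$, and $v_k=w_k$ for $k\ne i,j$. Let $X$ be its vertex set with the graph metric $d$, and $id=(o,o,o)$ its base point. Write $m_i(v)=m(v_i)$, $l_i(v)=l(v_i)$. Embed $X$ in the space of continuous functions $f:X\to\mathbb R$ with $f(id)=0$ (compact-open topology) by $x\mapsto d(x,\cdot)-d(x,id)$;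 let $\overline X$ be the closure of the image and $\partial X=\overline X\setminus X$ the horofunction boundary. For $W\subseteq X$ and $C\ge 0$ put $H(W,C)=\{z\in X : d(z,W)\le d(z,id)+C\}$, and for $\xi\in\partial X$ let $$S(\xi)=\overline{\bigcup_{C\ge 0}\ \bigcap_{U}\ \overline{H(U\cap X,C)}},$$ where $U$ runs over the neighbourhoods of $\xi$ in $\overline X$. Let $\alpha_n\in X$ be the vertex with $l_1=m_2=n$ and all other $m_i,l_i$ equal to $0$, whose upward path in $T_1$ follows edges labelled $1$. Let $\beta_n\in X$ be the vertex with $m_3=l_3=n$ and all other $m_i,l_i$ equal to $0$, whose upward path in $T_3$ follows edges labelled $1$. Then $(\alpha_n)$ is a geodesic ray from $id$, the limits $$\alpha(z)=\lim_{n\to\infty}\bigl(d(\alpha_n,z)-d(\alpha_n,id)\bigr),\qquad \beta(z)=\lim_{n\to\infty}\bigl(d(\beta_n,z)-d(\beta_n,id)\bigr)$$ exist for every $z\in X$ (so $\alpha$ is a Busemann function), $\alpha,\beta\in\partial X$, and $\beta\in S(\alpha)$. -/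

import Mathlib

open Filter Topology

/-! ### Horofunctions and stars at infinity of a based metric space -/

section Stars

variable {X : Type*} [MetricSpace X]

/-- Continuous real functions on `X` vanishing at the base point `x₀`, with the
compact-open topology (as a subspace of `C(X, ℝ)`). -/
abbrev BasedFun (x₀ : X) : Type _ := {f : C(X, ℝ) // f x₀ = 0}

/-- The embedding `x ↦ (z ↦ d(x, z) - d(x, x₀))`. -/
def horoEmb (x₀ x : X) : BasedFun x₀ :=
  ⟨⟨fun z => dist x z - dist x x₀, by fun_prop⟩, by simp⟩

/-- The horofunction bordification: the closure of the image of `X`. -/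
def horoClosure (x₀ : X) : Set (BasedFun x₀) := closure (Set.range (horoEmb x₀))

/-- The horofunction boundary. -/
def horoBoundary (x₀ : X) : Set (BasedFun x₀) := horoClosure x₀ \ Set.range (horoEmb x₀)

/-- The sequence `x` defines the horofunction `f`, i.e. `f z = lim (d(xₙ, z) - d(xₙ, x₀))`
for every `z`, the limit existing. -/
def DefinesHorofunction (x₀ : X) (x : ℕ → X) (f : BasedFun x₀) : Prop :=
  ∀ z, Tendsto (fun n => dist (x n) z - dist (x n) x₀) atTop (𝓝 (f.1 z))

/-- A (discrete) geodesic ray issuing from `x₀`. -/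
def IsGeodesicRay (x₀ : X) (x : ℕ → X) : Prop :=
  x 0 = x₀ ∧ ∀ m n : ℕ, dist (x m) (x n) = |(m : ℝ) - n|

/-- The halfspace `H(W, C)`; the distance to a set is the extended one, so that it is `∞`
for the empty set. -/
def halfspace (x₀ : X) (W : Set X) (C : ℝ) : Set X :=
  {z | Metric.infEDist z W ≤ ENNReal.ofReal (dist z x₀ + C)}

/-- The star of `ξ`. Here `U` runs over all neighbourhoods of `ξ`; the part of `U` in `X` is
its preimage under the embedding. As `horoClosure x₀` is closed, neighbourhoods and closures
may equally be taken in the ambient space. -/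
def starAtInfinity (x₀ : X) (ξ : BasedFun x₀) : Set (BasedFun x₀) :=
  closure (⋃ C : {C : ℝ // 0 ≤ C}, ⋂ U ∈ 𝓝 ξ,
    closure (horoEmb x₀ '' halfspace x₀ (horoEmb x₀ ⁻¹' U) C.1))

end Stars

/-! ### The labelled tree -/

/-- Vertices of the `(q + 1)`-valent tree in which every vertex has one predecessor (below it)
and `q` successors, the edges to the successors being labelled by `Fin q`.
Let `aₖ` be the `k`-th iterated predecessor of the base point `o = a₀`, and let `r k` be the
label of the edge between `aₖ₊₁` and `aₖ`. A vertex is reached from `o` in a unique way by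
moving down `m` steps to `aₘ` (`aₘ` is the greatest common ancestor of the vertex and `o`) and
then up, without backtracking, along edges whose labels are listed in `path`, the label of the
topmost edge coming first. -/
@[ext]
structure TreeVertex (q : ℕ) (r : ℕ → Fin q) where
  m : ℕ
  path : List (Fin q)
  nonbacktracking : ∀ k, m = k + 1 → path.getLast? ≠ some (r k)

namespace TreeVertex

variable {q : ℕ} {r : ℕ → Fin q}

/-- The base point. -/
def base (q : ℕ) (r : ℕ → Fin q) : TreeVertex q r := ⟨0, [], by simp⟩

/-- The distance up from the greatest common ancestor with the base point. -/
def l (v : TreeVertex q r) : ℕ := v.path.length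

/-- The height. -/
def h (v : TreeVertex q r) : ℤ := (v.l : ℤ) - v.m

/-- The predecessor. -/
def pred : TreeVertex q r → TreeVertex q r
  | ⟨m, [], _⟩ => ⟨m + 1, [], by simp⟩
  | ⟨m, e :: p, hp⟩ => ⟨m, p, by
      intro k hk
      cases p with
      | nil => simp
      | cons a p => simpa [List.getLast?_cons_cons] using hp k hk⟩

/-- The label of the edge joining a vertex to its predecessor. -/
def label : TreeVertex q r → Fin q
  | ⟨m, [], _⟩ => r m
  | ⟨_, e :: _, _⟩ => e

/-- Every vertex has exactly one successor for each label. -/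
theorem pred_label_bijective :
    Function.Bijective fun v : TreeVertex q r => (v.pred, v.label) := by
  constructor
  · rintro ⟨m, p, hp⟩ ⟨m', p', hp'⟩ heq
    have hm := congrArg (fun x => x.1.m) heq
    have hpath := congrArg (fun x => x.1.path) heq
    have hl := congrArg Prod.snd heq
    cases p with
    | nil =>
      cases p' with
      | nil =>
        simp only [pred] at hm
        obtain rfl : m = m' := by omega
        rfl
      | cons a p' =>
        simp only [pred, label] at hm hpath hl
        subst hpath
        exact absurd (by simp [hl]) (hp' m hm.symm)
    | cons b p =>
      cases p' with
      | nil =>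
        simp only [pred, label] at hm hpath hl
        subst hpath
        exact absurd (by simp [hl]) (hp m' hm)
      | cons a p' =>
        simp only [pred, label] at hm hpath hl
        subst hm hpath hl
        rfl
  · rintro ⟨⟨m, p, hp⟩, e⟩
    by_cases hc : ∃ k, m = k + 1 ∧ (e :: p).getLast? = some (r k)
    · obtain ⟨k, rfl, hk⟩ := hc
      cases p with
      | nil =>
        refine ⟨⟨k, [], by simp⟩, ?_⟩
        simp at hk
        simp [pred, label, hk]
      | cons a p =>
        rw [List.getLast?_cons_cons] at hk
        exact absurd hk (hp k rfl)
    · push Not at hc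
      exact ⟨⟨m, e :: p, hc⟩, rfl⟩

theorem h_pred (v : TreeVertex q r) : v.pred.h = v.h - 1 := by
  obtain ⟨m, p, hp⟩ := v
  cases p <;> simp [pred, h, l] <;> ring

theorem h_pred_iterate (v : TreeVertex q r) (n : ℕ) : (pred^[n] v).h = v.h - n := by
  induction n generalizing v with
  | zero => simp
  | succ n ih => rw [Function.iterate_succ_apply, ih, h_pred]; push_cast; ring

/-- The tree as a graph: edges join vertices to their predecessors. -/
def graph (q : ℕ) (r : ℕ → Fin q) : SimpleGraph (TreeVertex q r) where
  Adj v w := v = w.pred ∨ w = v.pred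
  symm := ⟨fun _ _ hvw => hvw.symm⟩
  loopless := ⟨fun v hv => by
    have hne : v = v.pred := by simpa using hv
    have := congrArg h hne
    rw [h_pred] at this
    omega⟩

/-- The `m`-th iterated predecessor of the base point. -/
def anc (r : ℕ → Fin q) (m : ℕ) : TreeVertex q r := ⟨m, [], by simp⟩

theorem iterate_pred_anc (m n : ℕ) : pred^[n] (anc r m) = anc r (m + n) := by
  induction n generalizing m with
  | zero => rfl
  | succ n ih =>
    rw [Function.iterate_succ_apply, show pred (anc r m) = anc r (m + 1) from rfl, ih]
    congr 1
    omega

theorem iterate_pred_length (v : TreeVertex q r) : pred^[v.path.length] v = anc r v.m := by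
  obtain ⟨m, p, hp⟩ := v
  induction p with
  | nil => rfl
  | cons e p ih =>
    simp only [List.length_cons, Function.iterate_succ_apply, pred]
    exact ih _

theorem exists_common_ancestor (v w : TreeVertex q r) :
    ∃ a b : ℕ, pred^[a] v = pred^[b] w := by
  refine ⟨w.m + v.path.length, v.m + w.path.length, ?_⟩
  rw [Function.iterate_add_apply, Function.iterate_add_apply, iterate_pred_length,
    iterate_pred_length, iterate_pred_anc, iterate_pred_anc, add_comm]

theorem exists_successor (v : TreeVertex q r) : ∃ w : TreeVertex q r, w.pred = v := by
  obtain ⟨w, hw⟩ := (pred_label_bijective (r := r)).2 (v, r 0)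
  exact ⟨w, congrArg Prod.fst hw⟩

theorem exists_iterate_successor (v : TreeVertex q r) (n : ℕ) :
    ∃ w : TreeVertex q r, pred^[n] w = v :=
  (Function.Surjective.iterate exists_successor n) v

end TreeVertex

/-! ### Diestel-Leader graphs -/

/-- Vertices of `DL_d(q)`: `d`-tuples of tree vertices with heights summing to zero. -/
@[ext]
structure DLVertex (d q : ℕ) (r : ℕ → Fin q) where
  proj : Fin d → TreeVertex q r
  sum_h : ∑ i, (proj i).h = 0

namespace DLVertex

variable {d q : ℕ} {r : ℕ → Fin q}

/-- The base point, also called `id`. -/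
def base (d q : ℕ) (r : ℕ → Fin q) : DLVertex d q r :=
  ⟨fun _ => TreeVertex.base q r, by simp [TreeVertex.base, TreeVertex.h, TreeVertex.l]⟩

/-- The Diestel-Leader graph `DL_d(q)`. -/
def graph (d q : ℕ) (r : ℕ → Fin q) : SimpleGraph (DLVertex d q r) where
  Adj v w := ∃ i j, i ≠ j ∧ (TreeVertex.graph q r).Adj (v.proj i) (w.proj i) ∧
    (TreeVertex.graph q r).Adj (v.proj j) (w.proj j) ∧
    ∀ k, k ≠ i → k ≠ j → v.proj k = w.proj k
  symm := ⟨fun _ _ ⟨i, j, hij, hi, hj, hk⟩ =>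
    ⟨i, j, hij, hi.symm, hj.symm, fun k h1 h2 => (hk k h1 h2).symm⟩⟩
  loopless := ⟨fun _ ⟨_, _, _, hi, _⟩ => hi.ne rfl⟩

/-- One can move down `n` steps in the tree `j` while retracing any `n` steps upward in
the tree `i`. -/
theorem reachable_move (n : ℕ) (v w : DLVertex d q r) {i j : Fin d} (hij : i ≠ j)
    (hi : TreeVertex.pred^[n] (w.proj i) = v.proj i)
    (hj : w.proj j = TreeVertex.pred^[n] (v.proj j))
    (hk : ∀ k, k ≠ i → k ≠ j → v.proj k = w.proj k) :
    (graph d q r).Reachable v w := by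
  induction n generalizing w with
  | zero =>
    have : v = w := by
      ext1
      funext k
      by_cases h1 : k = i
      · subst h1; exact hi.symm
      · by_cases h2 : k = j
        · subst h2; exact hj.symm
        · exact hk k h1 h2
    rw [this]
  | succ n ih =>
    have hsum : ∑ k, ((Function.update (Function.update w.proj i (w.proj i).pred) j
        (TreeVertex.pred^[n] (v.proj j))) k).h = 0 := by
      have key : ∀ k, ((Function.update (Function.update w.proj i (w.proj i).pred) j
          (TreeVertex.pred^[n] (v.proj j))) k).h =
          (w.proj k).h + ((if k = j then 1 else 0) - (if k = i then 1 else 0)) := by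
        intro k
        by_cases h2 : k = j
        · subst h2
          rw [Function.update_self, hj, TreeVertex.h_pred_iterate, TreeVertex.h_pred_iterate]
          simp [hij.symm]
          ring
        · rw [Function.update_of_ne h2]
          by_cases h1 : k = i
          · subst h1
            simp [TreeVertex.h_pred, h2]
            ring
          · simp [h1, h2]
      rw [Finset.sum_congr rfl fun k _ => key k]
      simp [Finset.sum_add_distrib, w.sum_h]
    refine (ih ⟨_, hsum⟩ ?_ ?_ ?_).trans (SimpleGraph.Adj.reachable ?_)
    · simp only [Function.update_of_ne hij, Function.update_self]
      exact hi
    · simp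
    · intro k h1 h2
      simp only [Function.update_of_ne h2, Function.update_of_ne h1]
      exact hk k h1 h2
    · refine ⟨i, j, hij, Or.inl ?_, Or.inr ?_, ?_⟩
      · simp [Function.update_of_ne hij]
      · simp only [Function.update_self]
        rw [hj, Function.iterate_succ_apply']
      · intro k h1 h2
        simp [Function.update_of_ne h1, Function.update_of_ne h2]

/-- Moving down `n` steps in the tree `j`, compensating in the tree `i`. -/
theorem exists_reachable_move (n : ℕ) (v : DLVertex d q r) {i j : Fin d} (hij : i ≠ j)
    (x : TreeVertex q r) (hx : TreeVertex.pred^[n] x = v.proj i) :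
    ∃ w, (graph d q r).Reachable v w ∧ w.proj i = x ∧
      w.proj j = TreeVertex.pred^[n] (v.proj j) ∧
      ∀ k, k ≠ i → k ≠ j → w.proj k = v.proj k := by
  have hsum : ∑ k, ((Function.update (Function.update v.proj i x) j
      (TreeVertex.pred^[n] (v.proj j))) k).h = 0 := by
    have hx' : x.h = (v.proj i).h + n := by
      rw [← hx, TreeVertex.h_pred_iterate]; ring
    have key : ∀ k, ((Function.update (Function.update v.proj i x) j
        (TreeVertex.pred^[n] (v.proj j))) k).h =
        (v.proj k).h + ((if k = i then (n : ℤ) else 0) - (if k = j then (n : ℤ) else 0)) := by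
      intro k
      by_cases h2 : k = j
      · subst h2
        rw [Function.update_self, TreeVertex.h_pred_iterate]
        simp [hij.symm]
        ring
      · rw [Function.update_of_ne h2]
        by_cases h1 : k = i
        · subst h1
          simp [hx', h2]
        · simp [h1, h2]
    rw [Finset.sum_congr rfl fun k _ => key k]
    simp [Finset.sum_add_distrib, v.sum_h]
  refine ⟨⟨_, hsum⟩, ?_, ?_, ?_, ?_⟩
  · apply reachable_move n _ _ hij
    · simpa [Function.update_of_ne hij] using hx
    · simp
    · intro k h1 h2
      simp [Function.update_of_ne h1, Function.update_of_ne h2]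
  · simp [Function.update_of_ne hij]
  · simp
  · intro k h1 h2
    simp [Function.update_of_ne h1, Function.update_of_ne h2]

theorem graph_connected (q : ℕ) (r : ℕ → Fin q) : (graph 3 q r).Connected := by
  have h01 : (0 : Fin 3) ≠ 1 := by decide
  have h02 : (0 : Fin 3) ≠ 2 := by decide
  have h12 : (1 : Fin 3) ≠ 2 := by decide
  -- two vertices that differ only in the first tree
  have step : ∀ v w : DLVertex 3 q r, v.proj 1 = w.proj 1 → v.proj 2 = w.proj 2 →
      (graph 3 q r).Reachable v w := by
    intro v w e1 e2
    obtain ⟨a, b, hab⟩ := TreeVertex.exists_common_ancestor (v.proj 0) (w.proj 0)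
    have hh : (v.proj 0).h = (w.proj 0).h := by
      have hv := v.sum_h
      have hw := w.sum_h
      rw [Fin.sum_univ_three] at hv hw
      rw [e1, e2] at hv
      omega
    have hab' : a = b := by
      have := congrArg TreeVertex.h hab
      rw [TreeVertex.h_pred_iterate, TreeVertex.h_pred_iterate] at this
      omega
    subst hab'
    obtain ⟨x, hx⟩ := TreeVertex.exists_iterate_successor (v.proj 1) a
    obtain ⟨v', rv, p1, p0, pk⟩ := exists_reachable_move a v h01.symm x hx
    refine rv.trans (reachable_move a w v' h01.symm ?_ ?_ ?_).symm
    · rw [p1, hx, e1]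
    · rw [p0, hab]
    · intro k k1 k0
      have : k = 2 := by omega
      subst this
      rw [pk 2 k1 k0, e2]
  have : Nonempty (DLVertex 3 q r) := ⟨base 3 q r⟩
  refine SimpleGraph.Connected.mk fun v w => ?_
  obtain ⟨a1, b1, hab1⟩ := TreeVertex.exists_common_ancestor (v.proj 1) (w.proj 1)
  obtain ⟨a2, b2, hab2⟩ := TreeVertex.exists_common_ancestor (v.proj 2) (w.proj 2)
  have down : ∀ (u : DLVertex 3 q r) (a b : ℕ), ∃ u', (graph 3 q r).Reachable u u' ∧
      u'.proj 1 = TreeVertex.pred^[a] (u.proj 1) ∧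
      u'.proj 2 = TreeVertex.pred^[b] (u.proj 2) := by
    intro u a b
    obtain ⟨x, hx⟩ := TreeVertex.exists_iterate_successor (u.proj 0) a
    obtain ⟨u1, ru1, -, p1, pk⟩ := exists_reachable_move a u h01 x hx
    obtain ⟨y, hy⟩ := TreeVertex.exists_iterate_successor (u1.proj 0) b
    obtain ⟨u2, ru2, -, p2, pk2⟩ := exists_reachable_move b u1 h02 y hy
    refine ⟨u2, ru1.trans ru2, ?_, ?_⟩
    · rw [pk2 1 h01.symm h12, p1]
    · rw [p2, pk 2 h02.symm h12.symm]
  obtain ⟨v', rv, v1, v2⟩ := down v a1 a2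
  obtain ⟨w', rw', w1, w2⟩ := down w b1 b2
  exact rv.trans ((step v' w' (by rw [v1, w1, hab1]) (by rw [v2, w2, hab2])).trans rw'.symm)

/-- The vertex set of `DL_3(q)` with the graph metric. -/
noncomputable instance : MetricSpace (DLVertex 3 q r) where
  dist v w := ((graph 3 q r).dist v w : ℝ)
  dist_self v := by simp
  dist_comm v w := by simp only [SimpleGraph.dist_comm]
  dist_triangle u v w := by exact_mod_cast (graph_connected q r).dist_triangle
  eq_of_dist_eq_zero {v w} hvw := by
    have hvw' : (graph 3 q r).dist v w = 0 := by exact_mod_cast hvw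
    exact (graph_connected q r).dist_eq_zero_iff.mp hvw'

/-- The vertex with `l₁ = m₂ = n` and all other `mᵢ, lᵢ` zero, whose upward path in the first
tree has all labels equal to `e`. -/
def alphaSeq (r : ℕ → Fin q) (e : Fin q) (n : ℕ) : DLVertex 3 q r :=
  ⟨![⟨0, List.replicate n e, by simp⟩, ⟨n, [], by simp⟩, TreeVertex.base q r], by
    simp [Fin.sum_univ_three, TreeVertex.base, TreeVertex.h, TreeVertex.l]⟩

/-- The vertex with `m₃ = l₃ = n` and all other `mᵢ, lᵢ` zero, whose upward path in the third
tree has all labels equal to `e`. Such a path does not backtrack as `e` is not the label of an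
edge below the base point. -/
def betaSeq (r : ℕ → Fin q) (e : Fin q) (he : ∀ k, r k ≠ e) (n : ℕ) : DLVertex 3 q r :=
  ⟨![TreeVertex.base q r, TreeVertex.base q r, ⟨n, List.replicate n e, by
      intro k _ hl
      have hmem := List.mem_of_getLast? hl
      exact he k (List.eq_of_mem_replicate hmem)⟩], by
    simp [Fin.sum_univ_three, TreeVertex.base, TreeVertex.h, TreeVertex.l]⟩

end DLVertex

/-! ### Limits of sequences as horofunctions, and a criterion for stars -/

section HorofunctionLimits

variable {X : Type*} [MetricSpace X] {x₀ : X} {x : ℕ → X} {f : BasedFun x₀}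

/-! Membership in the star rests on one inequality: `d(βₙ, αₖ) ≤ 2n = d(βₙ, id)` for `n ≥ k`. Each
neighbourhood `U` of `α` contains some `αₖ`, so `βₙ` lies in `H(U ∩ X, 0)` for large `n`, and so `β`
lies in its closure; `C = 0` suffices.

The inequality comes from the vertices `γₖ` with `l₁ = m₃ = k`. One has `d(αₖ, γₖ) ≤ k`, trading the
descent in `T₂` for one in `T₃`, then `d(γₖ, γₙ) ≤ n - k` and `d(γₙ, βₙ) ≤ n`. Conversely `d(βₙ, id)
≥ 2n`, since an edge changes `l₃ + m₃` by at most 1.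

The limit `α` exists by monotonicity along a geodesic ray. For `β`, whose sequence is not a ray,
`d(βₙ, z) - 2n` is shown to be eventually nonincreasing. Regrafting in `T₃` maps `βₙ` to `βₙ₊₁`, and
`dist_regraft_le` shows that this raises the distance to `z` by at most 2. Both limits are boundary
points because they are unbounded below: `α` on the ray itself, `β` on the `γₖ`. -/

theorem exists_definesHorofunction
    (h : ∀ z, ∃ c, Tendsto (fun n => dist (x n) z - dist (x n) x₀) atTop (𝓝 c)) :
    ∃ f : BasedFun x₀, DefinesHorofunction x₀ x f := by
  choose g hg using h
  have hlip : LipschitzWith 1 g := by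
    refine LipschitzWith.of_le_add fun y z => ?_
    refine le_of_tendsto_of_tendsto' (hg y) ((hg z).add_const (dist y z)) fun n => ?_
    linarith [dist_triangle_right (x n) y z, dist_triangle (x n) z y, dist_comm y z]
  refine ⟨⟨⟨g, hlip.continuous⟩, ?_⟩, hg⟩
  refine tendsto_nhds_unique (hg x₀) ?_
  simp

theorem DefinesHorofunction.dist_le (h : DefinesHorofunction x₀ x f) (y z : X) :
    |f.1 y - f.1 z| ≤ dist y z := by
  refine le_of_tendsto' ((h y).sub (h z)).abs fun n => ?_
  rw [sub_sub_sub_cancel_right, dist_comm (x n) y, dist_comm (x n) z]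
  exact abs_dist_sub_le y z (x n)

/-- All the functions involved are 1-Lipschitz, so pointwise convergence is locally uniform, which
gives convergence in the compact-open topology. -/
theorem DefinesHorofunction.tendsto_horoEmb (h : DefinesHorofunction x₀ x f) :
    Tendsto (fun n => horoEmb x₀ (x n)) atTop (𝓝 f) := by
  rw [tendsto_subtype_rng]
  refine ContinuousMap.tendsto_of_tendstoLocallyUniformly ?_
  rw [Metric.tendstoLocallyUniformly_iff]
  intro ε hε y
  refine ⟨Metric.ball y (ε / 3), Metric.ball_mem_nhds y (by positivity), ?_⟩
  filter_upwards [Metric.tendsto_nhds.1 (h y) (ε / 3) (by positivity)] with n hn z hz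
  rw [Real.dist_eq, abs_lt] at hn
  rw [Metric.mem_ball] at hz
  have h1 := abs_le.1 (h.dist_le z y)
  have h2 : |dist (x n) z - dist (x n) y| ≤ dist z y := by
    rw [dist_comm (x n) z, dist_comm (x n) y]
    exact abs_dist_sub_le z y (x n)
  rw [abs_le] at h2
  change dist (f.1 z) (dist (x n) z - dist (x n) x₀) < ε
  rw [Real.dist_eq, abs_lt]
  constructor <;> linarith [h1.1, h1.2, h2.1, h2.2, hn.1, hn.2]

/-- A horofunction that is unbounded below lies in the boundary. -/
theorem DefinesHorofunction.mem_horoBoundary (h : DefinesHorofunction x₀ x f)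
    (hf : ∀ k : ℕ, ∃ z, f.1 z ≤ -k) : f ∈ horoBoundary x₀ := by
  refine ⟨mem_closure_of_tendsto h.tendsto_horoEmb (Eventually.of_forall fun n => ⟨x n, rfl⟩), ?_⟩
  -- The function attached to a vertex `y` is bounded below by `-d(y, x₀)`.
  rintro ⟨y, rfl⟩
  obtain ⟨k, hk⟩ := exists_nat_gt (dist y x₀)
  obtain ⟨z, hz⟩ := hf k
  change dist y z - dist y x₀ ≤ -k at hz
  linarith [dist_nonneg (x := y) (y := z)]

theorem IsGeodesicRay.exists_definesHorofunction (h : IsGeodesicRay x₀ x) :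
    ∃ f : BasedFun x₀, DefinesHorofunction x₀ x f := by
  have hd : ∀ n, dist (x n) x₀ = n := fun n => by
    simpa [h.1] using h.2 n 0
  refine _root_.exists_definesHorofunction fun z => ⟨_, tendsto_atTop_ciInf ?_ ?_⟩
  -- Along the ray `d(xₙ, x₀)` grows by exactly 1 per step, and `d(xₙ, z)` by at most 1.
  · refine antitone_nat_of_succ_le fun n => ?_
    have := h.2 (n + 1) n
    rw [Nat.cast_succ, add_sub_cancel_left, abs_one] at this
    rw [hd, hd, Nat.cast_succ]
    linarith [dist_triangle (x (n + 1)) (x n) z]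
  · refine ⟨-dist z x₀, ?_⟩
    rintro _ ⟨n, rfl⟩
    linarith [dist_triangle (x n) z x₀]

theorem IsGeodesicRay.mem_horoBoundary (h : IsGeodesicRay x₀ x)
    (hf : DefinesHorofunction x₀ x f) : f ∈ horoBoundary x₀ := by
  refine hf.mem_horoBoundary fun k => ⟨x k, le_of_tendsto (hf (x k)) ?_⟩
  filter_upwards [eventually_ge_atTop k] with n hn
  have h0 := h.2 n 0
  have hn' : (k : ℝ) ≤ n := by exact_mod_cast hn
  rw [h.1, Nat.cast_zero, sub_zero, Nat.abs_cast] at h0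
  rw [h0, h.2, abs_of_nonneg (by linarith)]
  linarith

/-- If each point of a sequence defining `ξ` is eventually no further from `yₙ` than `x₀` is,
then the limit of `yₙ` lies in the star of `ξ`. -/
theorem DefinesHorofunction.mem_starAtInfinity {ξ η : BasedFun x₀} {y : ℕ → X}
    (hx : DefinesHorofunction x₀ x ξ) (hy : DefinesHorofunction x₀ y η)
    (h : ∀ k, ∀ᶠ n in atTop, dist (y n) (x k) ≤ dist (y n) x₀) :
    η ∈ starAtInfinity x₀ ξ := by
  refine subset_closure (Set.mem_iUnion.2 ⟨⟨0, le_rfl⟩, Set.mem_iInter₂.2 fun U hU => ?_⟩)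
  -- A single point `x k` in `U` suffices: the distance to it bounds the distance to `U ∩ X`.
  obtain ⟨k, hk⟩ := (hx.tendsto_horoEmb.eventually_mem hU).exists
  refine mem_closure_of_tendsto hy.tendsto_horoEmb ?_
  filter_upwards [h k] with n hn
  refine ⟨y n, ?_, rfl⟩
  have hmem : x k ∈ horoEmb x₀ ⁻¹' U := hk
  refine (Metric.infEDist_le_edist_of_mem hmem).trans ?_
  rw [edist_dist]
  exact ENNReal.ofReal_le_ofReal (by simpa using hn)

end HorofunctionLimits

/-! ### Edges of the tree and regrafting of branches -/

namespace TreeVertex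

variable {q : ℕ} {r : ℕ → Fin q}

theorem l_add_m_le_of_adj {x y : TreeVertex q r} (h : (graph q r).Adj x y) :
    y.l + y.m ≤ x.l + x.m + 1 := by
  obtain ⟨m, p, hp⟩ := x
  obtain ⟨m', p', hp'⟩ := y
  rcases h with h | h
  · cases p' <;> simp [pred, l] at h ⊢ <;> grind
  · cases p <;> simp [pred, l] at h ⊢ <;> grind

theorem h_le_of_adj {x y : TreeVertex q r} (h : (graph q r).Adj x y) : y.h ≤ x.h + 1 := by
  rcases h with rfl | rfl
  · rw [h_pred]; omega
  · rw [h_pred]; omega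

/-- Only edges of the downward ray from `o` change `m`, so both ends of such an edge are iterated
predecessors of `o`. -/
theorem path_eq_nil_of_adj {x y : TreeVertex q r} (h : (graph q r).Adj x y) (hm : x.m ≠ y.m) :
    y.path = [] := by
  obtain ⟨m, p, hp⟩ := x
  obtain ⟨m', p', hp'⟩ := y
  rcases h with h | h
  · cases p' <;> simp_all [pred]
  · cases p with
    | nil => exact congrArg path h
    | cons a p => simp_all [pred]

/-- Regraft `x` one step lower on the downward ray, through an edge labelled `e`. -/
def regraft (e : Fin q) (he : ∀ k, r k ≠ e) (x : TreeVertex q r) : TreeVertex q r :=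
  ⟨x.m + 1, x.path ++ [e], fun k _ h => he k (by simpa using h.symm)⟩

variable {e : Fin q} {he : ∀ k, r k ≠ e}

theorem h_regraft (x : TreeVertex q r) : (x.regraft e he).h = x.h := by
  simp [regraft, h, l]

theorem pred_regraft {x : TreeVertex q r} (hx : x.pred.m = x.m) :
    (x.regraft e he).pred = x.pred.regraft e he := by
  obtain ⟨m, p, hp⟩ := x
  cases p with
  | nil => simp [pred] at hx
  | cons a p => rfl

theorem pred_regraft_of_path_eq_nil {x : TreeVertex q r} (hx : x.path = []) :
    (x.regraft e he).pred = x.pred := by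
  obtain ⟨m, p, hp⟩ := x
  subst hx
  rfl

theorem regraft_adj {x y : TreeVertex q r} (h : (graph q r).Adj x y) (hm : x.m = y.m) :
    (graph q r).Adj (x.regraft e he) (y.regraft e he) := by
  rcases h with rfl | rfl
  · exact Or.inl (pred_regraft hm).symm
  · exact Or.inr (pred_regraft hm.symm).symm

end TreeVertex

/-! ### Distance estimates in the Diestel-Leader graph -/

namespace DLVertex

variable {q : ℕ} {r : ℕ → Fin q}

theorem dist_def (v w : DLVertex 3 q r) : dist v w = ((graph 3 q r).dist v w : ℝ) := rfl

theorem adj_or_eq_of_adj {v w : DLVertex 3 q r} (h : (graph 3 q r).Adj v w) (k : Fin 3) :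
    (TreeVertex.graph q r).Adj (v.proj k) (w.proj k) ∨ v.proj k = w.proj k := by
  obtain ⟨i, j, -, hi, hj, hk⟩ := h
  by_cases h1 : k = i
  · exact h1 ▸ Or.inl hi
  · by_cases h2 : k = j
    · exact h2 ▸ Or.inl hj
    · exact Or.inr (hk k h1 h2)

theorem le_add_dist {F : DLVertex 3 q r → ℝ}
    (hF : ∀ v w, (graph 3 q r).Adj v w → F w ≤ F v + 1) (v w : DLVertex 3 q r) :
    F w ≤ F v + dist v w := by
  obtain ⟨p, hp⟩ := (graph_connected q r).exists_walk_length_eq_dist v w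
  rw [dist_def, ← hp]
  clear hp
  induction p with
  | nil => simp
  | cons h p ih =>
    rw [SimpleGraph.Walk.length_cons]
    push_cast
    linarith [hF _ _ h]

theorem l_add_m_le (v w : DLVertex 3 q r) (k : Fin 3) :
    ((w.proj k).l + (w.proj k).m : ℝ) ≤ (v.proj k).l + (v.proj k).m + dist v w := by
  refine le_add_dist (F := fun v => ((v.proj k).l + (v.proj k).m : ℝ)) (fun v w h => ?_) v w
  rcases adj_or_eq_of_adj h k with h | h
  · exact_mod_cast TreeVertex.l_add_m_le_of_adj h
  · simp [h]

theorem h_le (v w : DLVertex 3 q r) (k : Fin 3) :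
    ((w.proj k).h : ℝ) ≤ (v.proj k).h + dist v w := by
  refine le_add_dist (F := fun v => ((v.proj k).h : ℝ)) (fun v w h => ?_) v w
  rcases adj_or_eq_of_adj h k with h | h
  · exact_mod_cast TreeVertex.h_le_of_adj h
  · simp [h]

theorem dist_le_one_of_adj {v w : DLVertex 3 q r} (h : (graph 3 q r).Adj v w) :
    dist v w ≤ 1 := by
  rw [dist_def, SimpleGraph.dist_eq_one_iff_adj.2 h, Nat.cast_one]

/-- Moving down `n` steps in the tree `j` while moving up `n` steps in the tree `i` takes at most
`n` steps. -/
theorem dist_le_of_move (n : ℕ) (v w : DLVertex 3 q r) {i j : Fin 3} (hij : i ≠ j)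
    (hi : TreeVertex.pred^[n] (w.proj i) = v.proj i)
    (hj : w.proj j = TreeVertex.pred^[n] (v.proj j))
    (hk : ∀ k, k ≠ i → k ≠ j → v.proj k = w.proj k) :
    dist v w ≤ n := by
  induction n generalizing v with
  | zero =>
    have : v = w := by
      ext1
      funext k
      by_cases h1 : k = i
      · exact h1 ▸ hi.symm
      · by_cases h2 : k = j
        · exact h2 ▸ hj.symm
        · exact hk k h1 h2
    simp [this]
  | succ n ih =>
    -- The vertex after the first of the `n + 1` moves.
    set g := Function.update (Function.update v.proj i (TreeVertex.pred^[n] (w.proj i))) j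
      (v.proj j).pred with hg
    have gj : g j = (v.proj j).pred := by simp [hg]
    have gi : g i = TreeVertex.pred^[n] (w.proj i) := by simp [hg, hij]
    have gk : ∀ k, k ≠ i → k ≠ j → g k = v.proj k := fun k h1 h2 => by simp [hg, h1, h2]
    rw [Function.iterate_succ_apply', ← gi] at hi
    have key : ∀ k, (g k).h =
        (v.proj k).h + ((if k = i then 1 else 0) - (if k = j then 1 else 0)) := by
      intro k
      by_cases h2 : k = j
      · subst h2
        rw [gj, TreeVertex.h_pred, if_neg hij.symm, if_pos rfl]
        ring
      · by_cases h1 : k = i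
        · subst h1
          rw [← hi, TreeVertex.h_pred, if_neg h2, if_pos rfl]
          ring
        · simp [gk k h1 h2, h1, h2]
    have hsum : ∑ k, (g k).h = 0 := by
      rw [Finset.sum_congr rfl fun k _ => key k]
      simp [Finset.sum_add_distrib, v.sum_h]
    have h1 : dist v ⟨g, hsum⟩ ≤ 1 :=
      dist_le_one_of_adj ⟨i, j, hij, Or.inl hi.symm, Or.inr gj, fun k h1 h2 => (gk k h1 h2).symm⟩
    have h2 : dist (⟨g, hsum⟩ : DLVertex 3 q r) w ≤ n := by
      refine ih _ gi.symm ?_ fun k h1 h2 => (gk k h1 h2).trans (hk k h1 h2)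
      rw [hj, Function.iterate_succ_apply]
      exact congrArg _ gj.symm
    push_cast
    linarith [dist_triangle v ⟨g, hsum⟩ w]

theorem pred_iterate_replicate (e : Fin q) (m n k : ℕ)
    (h : ∀ j, m = j + 1 → (List.replicate (n + k) e).getLast? ≠ some (r j))
    (h' : ∀ j, m = j + 1 → (List.replicate n e).getLast? ≠ some (r j)) :
    TreeVertex.pred^[k] (⟨m, List.replicate (n + k) e, h⟩ : TreeVertex q r) =
      ⟨m, List.replicate n e, h'⟩ := by
  induction k with
  | zero => rfl
  | succ k ih => exact ih _

/-! ### Effect of regrafting on distances -/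

section Regraft

variable {e : Fin q} {he : ∀ k, r k ≠ e}

/-- Regraft the third coordinate. -/
def regraft (e : Fin q) (he : ∀ k, r k ≠ e) (v : DLVertex 3 q r) : DLVertex 3 q r :=
  ⟨![v.proj 0, v.proj 1, (v.proj 2).regraft e he], by
    have := v.sum_h
    rw [Fin.sum_univ_three] at this
    simpa [Fin.sum_univ_three, TreeVertex.h_regraft] using this⟩

theorem regraft_adj {v w : DLVertex 3 q r} (h : (graph 3 q r).Adj v w)
    (hm : (v.proj 2).m = (w.proj 2).m) :
    (graph 3 q r).Adj (v.regraft e he) (w.regraft e he) := by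
  have lift : ∀ k, (TreeVertex.graph q r).Adj (v.proj k) (w.proj k) →
      (TreeVertex.graph q r).Adj ((v.regraft e he).proj k) ((w.regraft e he).proj k) := by
    intro k hk
    fin_cases k
    · exact hk
    · exact hk
    · exact TreeVertex.regraft_adj (he := he) hk hm
  have lift' : ∀ k, v.proj k = w.proj k → (v.regraft e he).proj k = (w.regraft e he).proj k := by
    intro k hk
    fin_cases k
    · exact hk
    · exact hk
    · exact congrArg (TreeVertex.regraft e he) hk
  obtain ⟨i, j, hij, hi, hj, hk⟩ := h
  exact ⟨i, j, hij, lift i hi, lift j hj, fun k h1 h2 => lift' k (hk k h1 h2)⟩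

/-- Here the third coordinate is some `aₘ`, and its regraft is the successor of `aₘ₊₁` labelled `e`:
one step down and one step up, while the first coordinate goes up and back. -/
theorem dist_regraft_le_two {w : DLVertex 3 q r} (hw : (w.proj 2).path = []) :
    dist w (w.regraft e he) ≤ 2 := by
  obtain ⟨s, hs⟩ := TreeVertex.exists_successor (w.proj 0)
  have hsum : ∑ k, ((![s, w.proj 1, (w.proj 2).pred] : Fin 3 → TreeVertex q r) k).h = 0 := by
    have := w.sum_h
    rw [Fin.sum_univ_three, ← hs, TreeVertex.h_pred] at this
    simp [Fin.sum_univ_three, TreeVertex.h_pred]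
    linarith
  have h1 : dist w ⟨_, hsum⟩ ≤ (1 : ℕ) := by
    refine dist_le_of_move 1 _ _ (i := 0) (j := 2) (by decide) hs rfl fun k h0 h2 => ?_
    obtain rfl : k = 1 := by omega
    rfl
  have h2 : dist (⟨_, hsum⟩ : DLVertex 3 q r) (w.regraft e he) ≤ (1 : ℕ) := by
    refine dist_le_of_move 1 _ _ (i := 2) (j := 0) (by decide) ?_ hs.symm fun k h2 h0 => ?_
    · exact TreeVertex.pred_regraft_of_path_eq_nil (he := he) hw
    · obtain rfl : k = 1 := by omega
      rfl
  push_cast at h1 h2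
  linarith [dist_triangle w ⟨_, hsum⟩ (w.regraft e he)]

/-- A geodesic from `w` to `v` must change `m₃`. Its part before the first such edge can be
regrafted without changing its length; at that edge the third coordinate is on the downward ray, so
a detour of length at most 2 rejoins the original geodesic. -/
theorem dist_regraft_le (v w : DLVertex 3 q r) (h : (v.proj 2).m ≠ (w.proj 2).m) :
    dist v (w.regraft e he) ≤ dist v w + 2 := by
  obtain ⟨p, hp⟩ := (graph_connected q r).exists_walk_length_eq_dist w v
  rw [dist_comm v w, dist_def w v, ← hp]
  clear hp
  induction p with
  | nil => exact absurd rfl h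
  | @cons w u v hwu p ih =>
    rw [SimpleGraph.Walk.length_cons]
    push_cast
    by_cases hm : (w.proj 2).m = (u.proj 2).m
    · have h1 := ih (hm ▸ h)
      have h2 := dist_le_one_of_adj (regraft_adj (e := e) (he := he) hwu hm)
      linarith [dist_triangle_right v (w.regraft e he) (u.regraft e he)]
    · have hadj := (adj_or_eq_of_adj hwu.symm 2).resolve_right fun h => hm (by rw [h])
      have h1 := dist_regraft_le_two (e := e) (he := he)
        (TreeVertex.path_eq_nil_of_adj hadj (Ne.symm hm))
      have h2 := dist_le_one_of_adj hwu
      have h3 : dist v u ≤ p.length := by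
        rw [dist_comm, dist_def]
        exact_mod_cast SimpleGraph.dist_le p
      linarith [dist_triangle v u w, dist_triangle v w (w.regraft e he), dist_comm w u]

end Regraft

/-! ### The sequences `α`, `β` and the intermediate `γ` -/

section Sequences

variable (e : Fin q)

theorem alphaSeq_zero : alphaSeq r e 0 = base 3 q r := by
  ext1
  funext k
  fin_cases k <;> rfl

theorem isGeodesicRay_alphaSeq : IsGeodesicRay (base 3 q r) (alphaSeq r e) := by
  have hle : ∀ m k, dist (alphaSeq r e m) (alphaSeq r e (m + k)) = k := by
    intro m k
    apply le_antisymm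
    · refine dist_le_of_move k _ _ (i := 0) (j := 1) (by decide)
        (pred_iterate_replicate e 0 m k _ _) (TreeVertex.iterate_pred_anc m k).symm fun j h0 h1 => ?_
      obtain rfl : j = 2 := by omega
      rfl
    -- The height in the first tree rises by `k`, and by at most 1 per edge.
    · have := h_le (alphaSeq r e m) (alphaSeq r e (m + k)) 0
      simpa [alphaSeq, TreeVertex.h, TreeVertex.l] using this
  refine ⟨alphaSeq_zero e, fun m n => ?_⟩
  rcases le_total m n with h | h
  · obtain ⟨k, rfl⟩ := Nat.exists_eq_add_of_le h
    simp [hle]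
  · obtain ⟨k, rfl⟩ := Nat.exists_eq_add_of_le h
    rw [dist_comm]
    simp [hle]

/-- The vertex with `l₁ = m₃ = k` and all other `mᵢ, lᵢ` zero, whose upward path in the first
tree has all labels equal to `e`. -/
def gammaSeq (r : ℕ → Fin q) (e : Fin q) (k : ℕ) : DLVertex 3 q r :=
  ⟨![⟨0, List.replicate k e, by simp⟩, TreeVertex.base q r, TreeVertex.anc r k], by
    simp [Fin.sum_univ_three, TreeVertex.base, TreeVertex.anc, TreeVertex.h, TreeVertex.l]⟩

theorem dist_alphaSeq_gammaSeq_le (k : ℕ) : dist (alphaSeq r e k) (gammaSeq r e k) ≤ k := by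
  refine dist_le_of_move k _ _ (i := 1) (j := 2) (by decide) ?_ ?_ fun j h1 h2 => ?_
  · exact (TreeVertex.iterate_pred_anc 0 k).trans (by rw [zero_add]; rfl)
  · exact ((TreeVertex.iterate_pred_anc 0 k).trans (by rw [zero_add]; rfl)).symm
  · obtain rfl : j = 0 := by omega
    rfl

theorem dist_gammaSeq_gammaSeq_le (m k : ℕ) :
    dist (gammaSeq r e m) (gammaSeq r e (m + k)) ≤ k := by
  refine dist_le_of_move k _ _ (i := 0) (j := 2) (by decide)
    (pred_iterate_replicate e 0 m k _ _) (TreeVertex.iterate_pred_anc m k).symm fun j h0 h2 => ?_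
  obtain rfl : j = 1 := by omega
  rfl

variable (he : ∀ k, r k ≠ e)

theorem dist_gammaSeq_betaSeq_le_self (n : ℕ) :
    dist (gammaSeq r e n) (betaSeq r e he n) ≤ n := by
  have key : ∀ m (h : ∀ j, m = j + 1 → (List.replicate n e).getLast? ≠ some (r j)),
      TreeVertex.pred^[n] (⟨m, List.replicate n e, h⟩ : TreeVertex q r) = TreeVertex.anc r m := by
    intro m h
    have := TreeVertex.iterate_pred_length (⟨m, List.replicate n e, h⟩ : TreeVertex q r)
    rwa [List.length_replicate] at this
  refine dist_le_of_move n _ _ (i := 2) (j := 0) (by decide) (key n _) (key 0 _).symm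
    fun j h2 h0 => ?_
  obtain rfl : j = 1 := by omega
  rfl

theorem dist_betaSeq_gammaSeq_le {k n : ℕ} (h : k ≤ n) :
    dist (betaSeq r e he n) (gammaSeq r e k) ≤ 2 * n - k := by
  obtain ⟨j, rfl⟩ := Nat.exists_eq_add_of_le h
  rw [dist_comm]
  have h1 := dist_gammaSeq_gammaSeq_le (r := r) e k j
  have h2 := dist_gammaSeq_betaSeq_le_self e he (k + j)
  push_cast at h2 ⊢
  linarith [dist_triangle (gammaSeq r e k) (gammaSeq r e (k + j)) (betaSeq r e he (k + j))]

theorem dist_betaSeq_alphaSeq_le {k n : ℕ} (h : k ≤ n) :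
    dist (betaSeq r e he n) (alphaSeq r e k) ≤ 2 * n := by
  have h1 := dist_betaSeq_gammaSeq_le e he h
  have h2 := dist_alphaSeq_gammaSeq_le (r := r) e k
  linarith [dist_triangle_right (betaSeq r e he n) (alphaSeq r e k) (gammaSeq r e k)]

theorem dist_betaSeq_base (n : ℕ) : dist (betaSeq r e he n) (base 3 q r) = 2 * n := by
  apply le_antisymm
  · simpa [alphaSeq_zero] using dist_betaSeq_alphaSeq_le e he (Nat.zero_le n)
  · have := l_add_m_le (base 3 q r) (betaSeq r e he n) 2
    have hl : ((betaSeq r e he n).proj 2).l = n := List.length_replicate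
    have hm : ((betaSeq r e he n).proj 2).m = n := rfl
    have hl0 : ((base 3 q r).proj 2).l = 0 := rfl
    have hm0 : ((base 3 q r).proj 2).m = 0 := rfl
    rw [hl, hm, hl0, hm0, Nat.cast_zero, dist_comm] at this
    linarith

theorem regraft_betaSeq (n : ℕ) :
    (betaSeq r e he n).regraft e he = betaSeq r e he (n + 1) := by
  ext1
  funext k
  fin_cases k
  · rfl
  · rfl
  · ext1
    · rfl
    · exact List.replicate_succ'.symm

theorem exists_definesHorofunction_betaSeq :
    ∃ β, DefinesHorofunction (base 3 q r) (betaSeq r e he) β := by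
  refine exists_definesHorofunction fun z => ?_
  -- From this index on, `βₙ` and `z` have different `m₃`, as `dist_regraft_le` requires.
  set N := (z.proj 2).m + 1
  suffices h : ∃ c, Tendsto (fun n => dist (betaSeq r e he (n + N)) z -
      dist (betaSeq r e he (n + N)) (base 3 q r)) atTop (𝓝 c) by
    obtain ⟨c, hc⟩ := h
    exact ⟨c, (tendsto_add_atTop_iff_nat
      (f := fun n => dist (betaSeq r e he n) z - dist (betaSeq r e he n) (base 3 q r)) N).1 hc⟩
  refine ⟨_, tendsto_atTop_ciInf (antitone_nat_of_succ_le fun n => ?_) ⟨-dist z (base 3 q r), ?_⟩⟩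
  · have hne : (z.proj 2).m ≠ ((betaSeq r e he (n + N)).proj 2).m := by
      change (z.proj 2).m ≠ n + ((z.proj 2).m + 1)
      omega
    have h1 := dist_regraft_le (e := e) (he := he) _ _ hne
    rw [regraft_betaSeq, dist_comm, dist_comm z] at h1
    rw [dist_betaSeq_base, dist_betaSeq_base, add_right_comm]
    push_cast
    linarith
  · rintro _ ⟨n, rfl⟩
    linarith [dist_triangle (betaSeq r e he (n + N)) z (base 3 q r)]

end Sequences

end DLVertex

theorem mainTheorem2 (q : ℕ) (hq : 2 ≤ q) (r : ℕ → Fin q) (hr : ∀ k, r k ≠ ⟨1, hq⟩) :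
    ∃ α β : BasedFun (DLVertex.base 3 q r),
      IsGeodesicRay (DLVertex.base 3 q r) (DLVertex.alphaSeq r ⟨1, hq⟩) ∧
      DefinesHorofunction (DLVertex.base 3 q r) (DLVertex.alphaSeq r ⟨1, hq⟩) α ∧
      DefinesHorofunction (DLVertex.base 3 q r) (DLVertex.betaSeq r ⟨1, hq⟩ hr) β ∧
      α ∈ horoBoundary (DLVertex.base 3 q r) ∧
      β ∈ horoBoundary (DLVertex.base 3 q r) ∧
      β ∈ starAtInfinity (DLVertex.base 3 q r) α := by
  have hray := DLVertex.isGeodesicRay_alphaSeq (r := r) ⟨1, hq⟩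
  obtain ⟨α, hα⟩ := hray.exists_definesHorofunction
  obtain ⟨β, hβ⟩ := DLVertex.exists_definesHorofunction_betaSeq ⟨1, hq⟩ hr
  refine ⟨α, β, hray, hα, hβ, hray.mem_horoBoundary hα, hβ.mem_horoBoundary fun k => ?_,
    hα.mem_starAtInfinity hβ fun k => ?_⟩
  -- Since `d(βₙ, γₖ) ≤ 2n - k` for `n ≥ k`, the value `β(γₖ)` is at most `-k`.
  · refine ⟨DLVertex.gammaSeq r ⟨1, hq⟩ k, le_of_tendsto (hβ _) ?_⟩
    filter_upwards [eventually_ge_atTop k] with n hn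
    have := DLVertex.dist_betaSeq_gammaSeq_le ⟨1, hq⟩ hr hn
    rw [DLVertex.dist_betaSeq_base]
    linarith
  · filter_upwards [eventually_ge_atTop k] with n hn
    rw [DLVertex.dist_betaSeq_base]
    exact DLVertex.dist_betaSeq_alphaSeq_le ⟨1, hq⟩ hr hn
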